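/- Let $d$ be a dimension and let $\nu$ be a probability law of marks $(C,\sigma)$, where $C$ is a random non-empty compact subset of $\mathbb R^d$ (the grain, placed relative to its centre) with diameter $\xi$, and $\sigma\ge 0$ is a height. Assume that $\xi^d$ and $\sigma$ are light-tailed: ${\mathbf E}\,e^{c\xi^d}<\infty$ and ${\mathbf E}\,e^{c\sigma}<\infty$ for some $c>0$. The Poisson rain of intensity $\lambda>0$ is the Poisson point process of arrivals (location $x\in\mathbb R^d$, time $t\in\mathbb R$) of intensity $\lambda\,dx\,dt$ with i.i.d. marks of law $\nu$; an arrival at $x$ with mark $(C,\sigma)$ has footprint $x+C$. Let $\mathbb H_t^x\in[0,\infty]$ be the heights of the backward growth model with zero initial condition, that is, the (least) solution of $$\mathbb H_t^x=\Bigl(\sigma_{\tau}+\sup_{y\in C_{\tau}}\mathbb H^y_{t+\tau}\circ\theta_{\tau}\Bigr)\mathbf 1_{\tau\ge -t},$$ where $\tau=\tau^x_-(t)$ is the time of the last arrival before time $0$ whose footprint contains $x$, $C_\tau$ and $\sigma_\tau$ are the footprint and the height of that arrival, and $\theta_u$ is the time shift by $u$. Put $\mathbb H(t)=\mathbb H_t^0$,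 and let $\kappa(\lambda)\in[0,\infty]$ be the growth rate, i.e. the almost sure value of $\limsup_{t\to\infty}\mathbb H(t)/t$ for the Poisson rain of intensity $\lambda$ (in general: the least almost sure upper bound of this upper limit). Let $\lambda_c\in[0,\infty]$ be the critical intensity of the following Boolean model on $\mathbb Z^d$: at the sites $z\in\mathbb Z^d$ there are independent Poisson($\lambda$) numbers $M^z$ of arrivals with i.i.d. radii distributed as $\lfloor\xi\rfloor+1$; if $M^z\ge1$ there is a ball at $z$, the set of lattice points at $\ell_\infty$-distance at most $R^{z,\max}$ from $z$, where $R^{z,\max}$ is the largest of the $M^z$ radii; the clump of a site is the union of all balls that are connected, through chains of overlapping balls, to a ball covering the site (empty if no ball covers it). $\lambda_c$ is the supremum of the $\lambda$ such that, for every intensity up to $\lambda$, the clump of the origin is almost surely finite and its number of lattice points is light-tailed. Then, for all $0<a<\lambda_c$ and all $0<\lambda<\lambda_c$, $$\kappa(\lambda)=\frac{\lambda}{a}\,\kappa(a).$$ Moreover, for every $k\in[0,\infty]$, $\limsup_{t\to\infty}\mathbb H(t)/t=k$ almost surely for the Poisson rain of intensity $a$ if and only if $\limsup_{t\to\infty}\mathbb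 H(t)/t=\frac{\lambda}{a}k$ almost surely for the Poisson rain of intensity $\lambda$. -/

import Mathlib

open MeasureTheory ProbabilityTheory Filter TopologicalSpace
open scoped ENNReal NNReal

namespace PoissonHail

/-- The Euclidean space of dimension `d`. -/
abbrev Space (d : ℕ) : Type := EuclideanSpace ℝ (Fin d)

/-- Non-empty compact sets carry the Borel sigma-algebra of the Hausdorff metric; for compact sets
this is the usual sigma-algebra of random closed sets, generated by the hitting events. -/
instance instMeasurableSpaceGrain (d : ℕ) : MeasurableSpace (NonemptyCompacts (Space d)) :=
  borel _

instance instBorelSpaceGrain (d : ℕ) : BorelSpace (NonemptyCompacts (Space d)) := ⟨rfl⟩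

/-- A mark `(C, σ)`: a grain `C` (relative to its centre) and a height `σ`. -/
abbrev Mark (d : ℕ) : Type := NonemptyCompacts (Space d) × ℝ≥0

/-- The diameter `ξ` of the grain of a mark. -/
noncomputable def Mark.xi {d : ℕ} (m : Mark d) : ℝ := Metric.diam (m.1 : Set (Space d))

/-- A customer `(x, t, (C, σ))`: centre `x`, arrival time `t`, mark `(C, σ)`. -/
abbrev Customer (d : ℕ) : Type := Space d × ℝ × Mark d

section Customer

variable {d : ℕ}

/-- The arrival time of a customer. -/
def Customer.time (p : Customer d) : ℝ := p.2.1

/-- The height brought by a customer. -/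
def Customer.height (p : Customer d) : ℝ≥0 := p.2.2.2

/-- The footprint `x + C` of a customer. -/
def Customer.footprint (p : Customer d) : Set (Space d) :=
  (fun c => p.1 + c) '' (p.2.2.1 : Set (Space d))

end Customer

/-! ### The Poisson rain -/

/-- The mean measure `λ dx dt ν(dm)` of the independently marked Poisson rain of intensity `λ`
with mark distribution `ν`. -/
noncomputable def rainIntensity {d : ℕ} (ν : Measure (Mark d)) (lam : ℝ≥0) :
    Measure (Customer d) :=
  lam • (volume : Measure (Space d)).prod ((volume : Measure ℝ).prod ν)

/-- `Φ` is (on the probability space `(Ω, P)`) a Poisson rain of intensity `lam` whose marks are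
i.i.d. with law `ν`, given as the random set of its customers: the number of customers in a
measurable set of finite mean measure is Poisson distributed with that mean, and the numbers of
customers in disjoint sets are independent. -/
structure IsPoissonRain {d : ℕ} (ν : Measure (Mark d)) (lam : ℝ≥0)
    {Ω : Type} [MeasurableSpace Ω] (P : Measure Ω) (Φ : Ω → Set (Customer d)) : Prop where
  measurable_count : ∀ B : Set (Customer d), MeasurableSet B → rainIntensity ν lam B ≠ ∞ →
    Measurable (fun ω => (Φ ω ∩ B).encard)
  map_count : ∀ B : Set (Customer d), MeasurableSet B → rainIntensity ν lam B ≠ ∞ →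
    P.map (fun ω => (Φ ω ∩ B).encard) =
      (poissonMeasure (rainIntensity ν lam B).toNNReal).map (fun n : ℕ => (n : ℕ∞))
  indep_count : ∀ (n : ℕ) (B : Fin n → Set (Customer d)), (∀ i, MeasurableSet (B i)) →
    (∀ i, rainIntensity ν lam (B i) ≠ ∞) → Pairwise (fun i j => Disjoint (B i) (B j)) →
    iIndepFun (fun i ω => (Φ ω ∩ B i).encard) P

/-! ### The backward growth model -/

/-- The time shift `θ_u`: what happens at time `u` in `φ` happens at time `0` in `shift u φ`. -/
def shift {d : ℕ} (u : ℝ) (φ : Set (Customer d)) : Set (Customer d) :=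
  (fun p => (p.1, p.2.1 - u, p.2.2)) '' φ

/-- `p` is the last customer of `φ` whose footprint contains `x` among those that arrive in the
time interval `[-t, 0)`. -/
def IsLastArrival {d : ℕ} (φ : Set (Customer d)) (t : ℝ) (x : Space d) (p : Customer d) : Prop :=
  p ∈ φ ∧ x ∈ p.footprint ∧ p.time ∈ Set.Ico (-t) 0 ∧
    ∀ q ∈ φ, x ∈ q.footprint → q.time ∈ Set.Ico (-t) 0 → q.time ≤ p.time

/-- The right-hand side of the backward growth equation
`ℍ_t^x = (σ_τ + sup_{y ∈ C_τ} ℍ_{t+τ}^y ∘ θ_τ) 1_{τ ≥ -t}`, where `τ` is the time of the last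
arrival before time `0` whose footprint contains `x`. If there is no such arrival in `[-t, 0)`,
the value is `0`. The supremum over `p` is over (almost surely) at most one customer. -/
noncomputable def growthStep (d : ℕ) :
    (Set (Customer d) → ℝ → Space d → ℝ≥0∞) →o (Set (Customer d) → ℝ → Space d → ℝ≥0∞) where
  toFun H φ t x := ⨆ (p : Customer d) (_ : IsLastArrival φ t x p),
    ((p.height : ℝ≥0∞) + ⨆ y ∈ p.footprint, H (shift p.time φ) (t + p.time) y)
  monotone' := by
    intro H K hHK φ t x
    refine iSup₂_mono fun p _ => ?_
    gcongr
    exact hHK _ _ _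

/-- The heights `ℍ_t^x` of the backward growth model with zero initial condition, as a function of
the arriving customers: the (least) solution of the backward growth equation. -/
noncomputable def backwardHeight {d : ℕ} (φ : Set (Customer d)) (t : ℝ) (x : Space d) : ℝ≥0∞ :=
  OrderHom.lfp (growthStep d) φ t x

/-- `ℍ` solves the backward growth equation. -/
theorem backwardHeight_eq {d : ℕ} (φ : Set (Customer d)) (t : ℝ) (x : Space d) :
    backwardHeight φ t x = ⨆ (p : Customer d) (_ : IsLastArrival φ t x p),
      ((p.height : ℝ≥0∞) +
        ⨆ y ∈ p.footprint, backwardHeight (shift p.time φ) (t + p.time) y) :=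
  (congrFun (congrFun (congrFun (OrderHom.map_lfp (growthStep d)) φ) t) x).symm

/-- `limsup_{t → ∞} ℍ(t) / t`, where `ℍ(t)` is the height at the origin. -/
noncomputable def limsupRate {d : ℕ} (φ : Set (Customer d)) : ℝ≥0∞ :=
  limsup (fun t : ℝ => backwardHeight φ t 0 / ENNReal.ofReal t) atTop

/-- `k` is the growth rate at intensity `lam`: for the Poisson rain of intensity `lam`,
`limsup_{t → ∞} ℍ(t) / t = k` almost surely. -/
def IsGrowthRate {d : ℕ} (ν : Measure (Mark d)) (lam : ℝ≥0) (k : ℝ≥0∞) : Prop :=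
  ∀ (Ω : Type) [MeasurableSpace Ω] (P : Measure Ω) [IsProbabilityMeasure P]
    (Φ : Ω → Set (Customer d)), IsPoissonRain ν lam P Φ → ∀ᵐ ω ∂P, limsupRate (Φ ω) = k

/-- The growth rate `κ(lam)`: the almost sure value of `limsup_{t → ∞} ℍ(t) / t` for the Poisson
rain of intensity `lam`, written as the least almost sure upper bound of this upper limit, so that
it is defined without reference to the fact that the upper limit is almost surely constant. -/
noncomputable def growthRate {d : ℕ} (ν : Measure (Mark d)) (lam : ℝ≥0) : ℝ≥0∞ :=
  sInf {k : ℝ≥0∞ | ∀ (Ω : Type) [MeasurableSpace Ω] (P : Measure Ω) [IsProbabilityMeasure P]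
    (Φ : Ω → Set (Customer d)), IsPoissonRain ν lam P Φ → ∀ᵐ ω ∂P, limsupRate (Φ ω) ≤ k}

/-- If the upper limit is almost surely equal to the constant `k`, then `κ(lam) = k`. -/
theorem IsGrowthRate.growthRate_eq {d : ℕ} {ν : Measure (Mark d)} {lam : ℝ≥0} {k : ℝ≥0∞}
    (hk : IsGrowthRate ν lam k) {Ω : Type} [MeasurableSpace Ω] {P : Measure Ω}
    [IsProbabilityMeasure P] {Φ : Ω → Set (Customer d)} (hΦ : IsPoissonRain ν lam P Φ) :
    growthRate ν lam = k := by
  refine le_antisymm (sInf_le ?_) (le_sInf ?_)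
  · intro Ω' _ P' _ Φ' h'
    filter_upwards [hk Ω' P' Φ' h'] with ω hω using hω.le
  · intro b hb
    obtain ⟨ω, h1, h2⟩ := ((hk Ω P Φ hΦ).and (hb Ω P Φ hΦ)).exists
    exact h1 ▸ h2

/-! ### The discrete Boolean model and the critical intensity -/

/-- A realization of the arrivals of one unit time slot on the lattice: at each site `z`, the
number `M^z` of arrivals and the sequence of marks, of which the first `M^z` are used. -/
abbrev Slot (d : ℕ) : Type := (Fin d → ℤ) → ℕ × (ℕ → Mark d)

/-- The law of a slot: all variables are independent, the numbers `M^z` are Poisson with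
parameter `lam`, and the marks have law `ν`. -/
noncomputable def slotLaw {d : ℕ} (ν : Measure (Mark d)) (lam : ℝ≥0) : Measure (Slot d) :=
  Measure.infinitePi fun _ : Fin d → ℤ =>
    (poissonMeasure lam).prod (Measure.infinitePi fun _ : ℕ => ν)

/-- The half-side `⌊ξ⌋ + 1` of the cube that replaces a grain of diameter `ξ`. -/
noncomputable def halfSide {d : ℕ} (m : Mark d) : ℕ := ⌊m.xi⌋₊ + 1

/-- The maximal half-side `R^{z,max}` of the cubes that arrive at `z` (zero if there are none). -/
noncomputable def maxHalfSide {d : ℕ} (s : Slot d) (z : Fin d → ℤ) : ℕ :=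
  (Finset.range (s z).1).sup fun i => halfSide ((s z).2 i)

/-- There is a ball at `z` if there is at least one arrival at `z`. -/
def HasBall {d : ℕ} (s : Slot d) (z : Fin d → ℤ) : Prop := 1 ≤ (s z).1

/-- The lattice points of the supremum-norm ball with centre `z` and radius `R^{z,max}`. -/
def ball {d : ℕ} (s : Slot d) (z : Fin d → ℤ) : Set (Fin d → ℤ) :=
  {y | ∀ i, |y i - z i| ≤ (maxHalfSide s z : ℤ)}

/-- The balls at `u` and `v` exist and overlap. -/
def Overlap {d : ℕ} (s : Slot d) (u v : Fin d → ℤ) : Prop :=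
  HasBall s u ∧ HasBall s v ∧ (ball s u ∩ ball s v).Nonempty

/-- The clump containing `z`: the union of all balls connected, through a chain of overlapping
balls, to a ball that covers `z`; it is empty if no ball covers `z`. -/
def clump {d : ℕ} (s : Slot d) (z : Fin d → ℤ) : Set (Fin d → ℤ) :=
  {y | ∃ u v, HasBall s u ∧ z ∈ ball s u ∧ Relation.ReflTransGen (Overlap s) u v ∧
    HasBall s v ∧ y ∈ ball s v}

/-- A random variable is light-tailed if it has a finite exponential moment. -/
def LightTailed {α : Type*} [MeasurableSpace α] (μ : Measure α) (X : α → ℝ) : Prop :=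
  ∃ c : ℝ, 0 < c ∧ ∫⁻ ω, ENNReal.ofReal (Real.exp (c * X ω)) ∂μ < ∞

/-- At intensity `lam`, the clump is almost surely finite and its number of lattice points is
light-tailed. -/
def Subcritical {d : ℕ} (ν : Measure (Mark d)) (lam : ℝ≥0) : Prop :=
  (∀ᵐ s ∂slotLaw ν lam, (clump s 0).Finite) ∧
    LightTailed (slotLaw ν lam) (fun s => ((clump s 0).ncard : ℝ))

/-- The critical intensity `λ_c` (possibly infinite), below which the clump is almost surely finite
and light-tailed. -/
noncomputable def criticalIntensity {d : ℕ} (ν : Measure (Mark d)) : ℝ≥0∞ :=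
  ⨆ (lam : ℝ≥0) (_ : ∀ lam' ≤ lam, Subcritical ν lam'), (lam : ℝ≥0∞)

end PoissonHail

namespace PoissonHail

/-! Heights depend on arrival times only through their order, so dilating time by `c > 0` carries
the growth process along: the dilated rain has at horizon `c * t` the height that the original has
at `t` (`backwardHeight_dilate`). Division by time makes the original rate `c` times the dilated one
(`limsupRate_dilate`). Dilation also turns a rain of intensity `lam` into one of intensity `lam / c`
on the same probability space (`IsPoissonRain.dilate`). With `c = lam / a`, almost sure statements
at intensity `a` become statements at `lam`. -/

variable {d : ℕ}

/-! ### Time dilation of a configuration -/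

/-- The dilation of time by the factor `c`, as a bijection of the space of customers. -/
noncomputable def dilate (c : ℝ≥0) (hc : c ≠ 0) : Customer d ≃ Customer d :=
  (Equiv.refl _).prodCongr
    ((Equiv.mulLeft₀ (c : ℝ) (NNReal.coe_ne_zero.2 hc)).prodCongr (Equiv.refl _))

theorem dilate_apply (c : ℝ≥0) (hc : c ≠ 0) (p : Customer d) :
    dilate c hc p = (p.1, (c : ℝ) * p.2.1, p.2.2) := rfl

theorem time_dilate (c : ℝ≥0) (hc : c ≠ 0) (p : Customer d) :
    (dilate c hc p).time = c * p.time := rfl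

theorem height_dilate (c : ℝ≥0) (hc : c ≠ 0) (p : Customer d) :
    (dilate c hc p).height = p.height := rfl

theorem footprint_dilate (c : ℝ≥0) (hc : c ≠ 0) (p : Customer d) :
    (dilate c hc p).footprint = p.footprint := rfl

theorem dilate_inv_image (c : ℝ≥0) (hc : c ≠ 0) (φ : Set (Customer d)) :
    dilate c⁻¹ (inv_ne_zero hc) '' (dilate c hc '' φ) = φ := by
  have hc' : (c : ℝ) ≠ 0 := NNReal.coe_ne_zero.2 hc
  rw [Set.image_image]
  simp [dilate_apply, hc']

theorem shift_dilate_image (c : ℝ≥0) (hc : c ≠ 0) (u : ℝ) (φ : Set (Customer d)) :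
    shift (c * u) (dilate c hc '' φ) = dilate c hc '' shift u φ := by
  simp only [shift, Set.image_image, dilate_apply, mul_sub]

theorem isLastArrival_dilate (c : ℝ≥0) (hc : c ≠ 0) (φ : Set (Customer d)) (t : ℝ)
    (x : Space d) (p : Customer d) :
    IsLastArrival (dilate c hc '' φ) (c * t) x (dilate c hc p) ↔ IsLastArrival φ t x p := by
  have hc' : (0 : ℝ) < c := NNReal.coe_pos.2 (pos_iff_ne_zero.2 hc)
  have hIco (s : ℝ) : (c : ℝ) * s ∈ Set.Ico (-(c * t)) 0 ↔ s ∈ Set.Ico (-t) 0 := by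
    rw [Set.mem_Ico, Set.mem_Ico, ← mul_neg, mul_le_mul_iff_right₀ hc', ← not_le, ← not_le,
      mul_nonneg_iff_of_pos_left hc']
  simp only [IsLastArrival, Set.forall_mem_image, time_dilate, footprint_dilate, hIco,
    mul_le_mul_iff_right₀ hc', (dilate c hc).injective.mem_set_image]

/-- The growth step commutes with the dilation of time. -/
theorem growthStep_dilate (c : ℝ≥0) (hc : c ≠ 0)
    (H : Set (Customer d) → ℝ → Space d → ℝ≥0∞) (φ : Set (Customer d)) (t : ℝ) (x : Space d) :
    growthStep d (fun φ t x => H (dilate c hc '' φ) (c * t) x) φ t x =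
      growthStep d H (dilate c hc '' φ) (c * t) x := by
  -- The bijection `dilate` reindexes the supremum over customers.
  refine (dilate c hc).iSup_congr fun p => ?_
  simp only [isLastArrival_dilate, height_dilate, footprint_dilate, time_dilate,
    shift_dilate_image, mul_add]

/-- The right-hand side, as a function of the undilated data, is again a fixed point of
`growthStep`, hence dominates the least one. -/
theorem backwardHeight_le_dilate (c : ℝ≥0) (hc : c ≠ 0) (φ : Set (Customer d)) (t : ℝ)
    (x : Space d) :
    backwardHeight φ t x ≤ backwardHeight (dilate c hc '' φ) (c * t) x := by
  have h : OrderHom.lfp (growthStep d) ≤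
      fun φ t x => OrderHom.lfp (growthStep d) (dilate c hc '' φ) (c * t) x := by
    refine OrderHom.lfp_le _ fun φ t x => ?_
    rw [growthStep_dilate, OrderHom.map_lfp]
  exact h φ t x

/-- The heights of the backward growth model are invariant under the dilation of time. -/
theorem backwardHeight_dilate (c : ℝ≥0) (hc : c ≠ 0) (φ : Set (Customer d)) (t : ℝ)
    (x : Space d) :
    backwardHeight (dilate c hc '' φ) (c * t) x = backwardHeight φ t x := by
  refine le_antisymm ?_ (backwardHeight_le_dilate c hc φ t x)
  -- The reverse inequality is the same bound for the inverse dilation.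
  have h := backwardHeight_le_dilate c⁻¹ (inv_ne_zero hc) (dilate c hc '' φ) (c * t) x
  rwa [dilate_inv_image, NNReal.coe_inv, inv_mul_cancel_left₀ (NNReal.coe_ne_zero.2 hc)] at h

theorem limsupRate_dilate (c : ℝ≥0) (hc : c ≠ 0) (φ : Set (Customer d)) :
    limsupRate φ = c * limsupRate (dilate c hc '' φ) := by
  have hc' : (0 : ℝ) < c := NNReal.coe_pos.2 (pos_iff_ne_zero.2 hc)
  have hmap : map (fun t : ℝ => (c : ℝ) * t) atTop = atTop :=
    (OrderIso.mulLeft₀ (c : ℝ) hc').map_atTop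
  have hcomp : limsupRate (dilate c hc '' φ) = limsup (fun t : ℝ =>
      backwardHeight (dilate c hc '' φ) (c * t) 0 / ENNReal.ofReal (c * t)) atTop := by
    rw [limsupRate]
    -- Only the filter on the left is rewritten; a limsup along `map` is by definition the limsup of
    -- the composition.
    nth_rw 1 [← hmap]
    rfl
  rw [hcomp, ← ENNReal.limsup_const_mul_of_ne_top ENNReal.coe_ne_top, limsupRate]
  refine limsup_congr (Eventually.of_forall fun t => ?_)
  have hc0 : (c : ℝ≥0∞) ≠ 0 := ENNReal.coe_ne_zero.2 hc
  rw [backwardHeight_dilate, ENNReal.ofReal_mul c.coe_nonneg, ENNReal.ofReal_coe_nnreal,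
    ← mul_div_assoc, ENNReal.mul_div_mul_left _ _ hc0 ENNReal.coe_ne_top]

/-! ### The Poisson rain under dilation -/

theorem measurable_dilate (c : ℝ≥0) (hc : c ≠ 0) : Measurable (dilate (d := d) c hc) := by
  change Measurable fun p : Customer d => (p.1, (c : ℝ) * p.2.1, p.2.2)
  fun_prop

/-- Dilating time by `c` divides the intensity by `c`. -/
theorem map_dilate_rainIntensity (ν : Measure (Mark d)) [SFinite ν] (lam c : ℝ≥0)
    (hc : c ≠ 0) :
    (rainIntensity ν lam).map (dilate c hc) = rainIntensity ν (lam / c) := by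
  have hc' : (c : ℝ) ≠ 0 := NNReal.coe_ne_zero.2 hc
  have hmul : (volume : Measure ℝ).map (fun t => (c : ℝ) * t) = c⁻¹ • volume := by
    rw [Real.map_volume_mul_left hc', abs_of_nonneg (by positivity), ← NNReal.coe_inv,
      ENNReal.ofReal_coe_nnreal]
    rfl
  have hd : ⇑(dilate (d := d) c hc) = Prod.map id (Prod.map (fun t => (c : ℝ) * t) id) := rfl
  have hm : Measurable fun t : ℝ => (c : ℝ) * t := measurable_const_mul _
  rw [rainIntensity, rainIntensity, Measure.map_smul, hd,
    ← Measure.map_prod_map _ _ measurable_id (hm.prodMap measurable_id),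
    ← Measure.map_prod_map _ _ hm measurable_id, Measure.map_id, Measure.map_id, hmul,
    Measure.prod_smul_left, Measure.prod_smul_right, smul_smul, div_eq_mul_inv]

/-- Counts of the dilated rain in `B` are counts of the original in the preimage of `B`, which has
the same mean, so each defining property is inherited. -/
theorem IsPoissonRain.dilate {ν : Measure (Mark d)} [SFinite ν] {lam : ℝ≥0} {Ω : Type}
    [MeasurableSpace Ω] {P : Measure Ω} {Φ : Ω → Set (Customer d)}
    (h : IsPoissonRain ν lam P Φ) (c : ℝ≥0) (hc : c ≠ 0) :
    IsPoissonRain ν (lam / c) P (fun ω => PoissonHail.dilate c hc '' Φ ω) := by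
  have hcount (B : Set (Customer d)) (ω : Ω) :
      (PoissonHail.dilate c hc '' Φ ω ∩ B).encard =
        (Φ ω ∩ PoissonHail.dilate c hc ⁻¹' B).encard := by
    rw [← Set.image_inter_preimage, (PoissonHail.dilate c hc).injective.encard_image]
  have hm := measurable_dilate (d := d) c hc
  have hint (B : Set (Customer d)) (hB : MeasurableSet B) :
      rainIntensity ν (lam / c) B = rainIntensity ν lam (PoissonHail.dilate c hc ⁻¹' B) := by
    rw [← map_dilate_rainIntensity ν lam c hc, Measure.map_apply hm hB]
  refine ⟨fun B hB hfin => ?_, fun B hB hfin => ?_, fun n B hB hfin hdisj => ?_⟩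
  · simp only [hcount]
    exact h.measurable_count _ (hm hB) (hint B hB ▸ hfin)
  · simp only [hcount, hint B hB]
    exact h.map_count _ (hm hB) (hint B hB ▸ hfin)
  · simp only [hcount]
    exact h.indep_count n _ (fun i => hm (hB i)) (fun i => hint _ (hB i) ▸ hfin i)
      fun i j hij => (hdisj hij).preimage _

/-! ### Transfer between intensities -/

/-- An almost sure statement on the upper limit at intensity `a` implies the rescaled statement at
intensity `lam`. -/
theorem ae_limsupRate_rescale {ν : Measure (Mark d)} [SFinite ν] {a lam : ℝ≥0} (ha : a ≠ 0)
    (hlam : lam ≠ 0) {p q : ℝ≥0∞ → Prop}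
    (hpq : ∀ r, p r → q (((lam / a : ℝ≥0) : ℝ≥0∞) * r))
    (h : ∀ (Ω : Type) [MeasurableSpace Ω] (P : Measure Ω) [IsProbabilityMeasure P]
      (Φ : Ω → Set (Customer d)), IsPoissonRain ν a P Φ → ∀ᵐ ω ∂P, p (limsupRate (Φ ω)))
    (Ω : Type) [MeasurableSpace Ω] (P : Measure Ω) [IsProbabilityMeasure P]
    (Φ : Ω → Set (Customer d)) (hΦ : IsPoissonRain ν lam P Φ) :
    ∀ᵐ ω ∂P, q (limsupRate (Φ ω)) := by
  have hc : lam / a ≠ 0 := div_ne_zero hlam ha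
  have hΦ' := hΦ.dilate (lam / a) hc
  rw [div_div_cancel₀ hlam] at hΦ'
  filter_upwards [h Ω P _ hΦ'] with ω hω
  rw [limsupRate_dilate (lam / a) hc]
  exact hpq _ hω

theorem div_mul_div_mul_cancel {a b : ℝ≥0} (ha : a ≠ 0) (hb : b ≠ 0) (r : ℝ≥0∞) :
    ((a / b : ℝ≥0) : ℝ≥0∞) * (((b / a : ℝ≥0) : ℝ≥0∞) * r) = r := by
  rw [← mul_assoc, ← ENNReal.coe_mul, div_mul_div_cancel₀ hb, div_self ha, ENNReal.coe_one,
    one_mul]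

theorem isGrowthRate_iff (ν : Measure (Mark d)) [SFinite ν] {a lam : ℝ≥0} (ha : a ≠ 0)
    (hlam : lam ≠ 0) (k : ℝ≥0∞) :
    IsGrowthRate ν a k ↔ IsGrowthRate ν lam (((lam / a : ℝ≥0) : ℝ≥0∞) * k) := by
  refine ⟨ae_limsupRate_rescale (p := (· = k)) (q := (· = ((lam / a : ℝ≥0) : ℝ≥0∞) * k)) ha hlam
      fun r hr => hr ▸ rfl,
    ae_limsupRate_rescale (p := (· = ((lam / a : ℝ≥0) : ℝ≥0∞) * k)) (q := (· = k)) hlam ha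
      fun r hr => ?_⟩
  rw [hr, div_mul_div_mul_cancel ha hlam]

/-- Rescaling by `lam / a` sends almost sure upper bounds at `a` to almost sure upper bounds at
`lam`. -/
theorem growthRate_le (ν : Measure (Mark d)) [SFinite ν] {a lam : ℝ≥0} (ha : a ≠ 0)
    (hlam : lam ≠ 0) :
    growthRate ν lam ≤ ((lam / a : ℝ≥0) : ℝ≥0∞) * growthRate ν a := by
  have hc : ((lam / a : ℝ≥0) : ℝ≥0∞) ≠ 0 := ENNReal.coe_ne_zero.2 (div_ne_zero hlam ha)
  -- Moving the factor across leaves the infimum alone on the right, ready for `le_sInf`.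
  rw [mul_comm, ← ENNReal.div_le_iff hc ENNReal.coe_ne_top]
  refine le_sInf fun k hk => ?_
  rw [ENNReal.div_le_iff hc ENNReal.coe_ne_top, mul_comm]
  exact sInf_le (ae_limsupRate_rescale (p := (· ≤ k))
    (q := (· ≤ ((lam / a : ℝ≥0) : ℝ≥0∞) * k)) ha hlam (fun r hr => mul_le_mul_right hr _) hk)

theorem growthRate_eq (ν : Measure (Mark d)) [SFinite ν] {a lam : ℝ≥0} (ha : a ≠ 0)
    (hlam : lam ≠ 0) :
    growthRate ν lam = ((lam / a : ℝ≥0) : ℝ≥0∞) * growthRate ν a := by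
  refine le_antisymm (growthRate_le ν ha hlam) ?_
  -- The other inequality comes from exchanging `a` and `lam`.
  calc ((lam / a : ℝ≥0) : ℝ≥0∞) * growthRate ν a
      ≤ ((lam / a : ℝ≥0) : ℝ≥0∞) * (((a / lam : ℝ≥0) : ℝ≥0∞) * growthRate ν lam) := by
        gcongr
        exact growthRate_le ν hlam ha
    _ = growthRate ν lam := div_mul_div_mul_cancel hlam ha _

end PoissonHail

theorem lemma4 (d : ℕ) (ν : Measure (PoissonHail.Mark d)) [IsProbabilityMeasure ν]
    (hξ : PoissonHail.LightTailed ν (fun m => m.xi ^ d))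
    (hσ : PoissonHail.LightTailed ν (fun m => (m.2 : ℝ)))
    (a lam : ℝ≥0) (ha_pos : 0 < a) (hlam_pos : 0 < lam)
    (ha : (a : ℝ≥0∞) < PoissonHail.criticalIntensity ν)
    (hlam : (lam : ℝ≥0∞) < PoissonHail.criticalIntensity ν) :
    PoissonHail.growthRate ν lam = ((lam / a : ℝ≥0) : ℝ≥0∞) * PoissonHail.growthRate ν a ∧
      ∀ k : ℝ≥0∞, PoissonHail.IsGrowthRate ν a k ↔
        PoissonHail.IsGrowthRate ν lam (((lam / a : ℝ≥0) : ℝ≥0∞) * k) := by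
  exact ⟨PoissonHail.growthRate_eq ν ha_pos.ne' hlam_pos.ne',
    PoissonHail.isGrowthRate_iff ν ha_pos.ne' hlam_pos.ne'⟩
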